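/- A family $(X_i)_{i\in I}$ of real random variables on a common probability space is called a family of $m$-wise independent random signs if $\mathbb{P}\{X_i=1\}=\mathbb{P}\{X_i=-1\}=\tfrac12$ for every $i\in I$ and every $m$ of the $X_i$ are independent. For a real $n\times N$ matrix $A$ let $\|A\|=\max_{x\neq 0}\|Ax\|_2/\|x\|_2$ be its operator norm with respect to the Euclidean norms. There exists a numerical constant $c_2>0$ such that the following holds. Let $1\le n\le N$ and $k\ge 0$ be integers with $k\le c_2\sqrt N$, let $V$ be a random $n\times N$ matrix whose $nN$ entries are $2k$-wise independent random signs, and put $\xi=n/N\le 1$. Then, for every real $t\ge 0$, $$\mathbb{P}\left\{\frac{1}{\sqrt N}\|V\|\ge 1+\sqrt{\xi}+t\right\}\;\le\; 2n\left(1+\frac{t}{1+\sqrt{\xi}}\right)^{-2k}\;\le\; 2n\exp\left\{\frac{-2kt}{1+\sqrt{\xi}+t}\right\}.$$ -/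

import Mathlib

open MeasureTheory ProbabilityTheory

/-- Every `k` of the random variables `X i` are (mutually) independent. -/
def KWiseIndependent {Ω ι : Type*} [MeasurableSpace Ω] (k : ℕ) (X : ι → Ω → ℝ)
    (μ : Measure Ω) : Prop :=
  ∀ S : Finset ι, S.card = k → iIndepFun (fun i : S => X i) μ

/-- The random variables `X i` are `k`-wise independent random signs: each takes the values
`-1` and `1` with probability `1/2`, and they are `k`-wise independent. -/
structure IsKWiseIndependentRandomSigns {Ω ι : Type*} [MeasurableSpace Ω] (k : ℕ)
    (X : ι → Ω → ℝ) (μ : Measure Ω) : Prop where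
  measurable : ∀ i, Measurable (X i)
  prob_neg_one : ∀ i, μ {ω | X i ω = -1} = 1 / 2
  prob_one : ∀ i, μ {ω | X i ω = 1} = 1 / 2
  kWiseIndependent : KWiseIndependent k X μ

/-- The operator norm of a real matrix with respect to the Euclidean norms on
`ℝ^N` and `ℝ^n`. -/
noncomputable def euclideanOpNorm {n N : ℕ} (A : Matrix (Fin n) (Fin N) ℝ) : ℝ :=
  ‖(Matrix.toEuclideanLin A).toContinuousLinearMap‖

/-! The trace of `(V Vᵀ) ^ k` dominates `‖V‖ ^ (2 * k)` and is a polynomial in the entries, of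
degree at most `2 * k`, with natural coefficients. A monomial involves at most `2 * k` entries, so
its mean factors, and no moment of a sign exceeds the same moment of a standard Gaussian. Hence the
mean trace is at most its Gaussian value, and Markov's inequality gives the tail once that value is
bounded by `2 * n * (√N + √n) ^ (2 * k)`.

For a Gaussian matrix, rotation invariance reduces the quadratic forms of powers of the Gram matrix
to the first basis vector. Splitting off the first row `g` gives a renewal equation whose data are
quadratic forms at `g` of the other rows, transposed: a smaller Gaussian matrix independent of `g`.
Iteration yields the recursion of weighted Dyck paths, with a fresh chi-square weight on each level.
Chebyshev's association inequality merges these into two weights `X` (even levels) and `Y` (odd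
levels) without lowering any mixed moment (`lintegral_gramQuad_le`). Finally the Dyck polynomial is
at most `(√X + √Y) ^ (2 * k)` (`dyck_sq_le`), and exponential moments of chi-square variables cost
only a factor 2 when `k ≤ √N / 4`. -/

open scoped ENNReal

/-! ### Renewal sequences and Dyck polynomials. -/

/-- The `j`-th term of the renewal sequence `c₀ = 1`, `c_{j+1} = ∑_{i ≤ j} b_i c_{j-i}`, as a
polynomial in the variables `b_i`. -/
noncomputable def renewalPoly : ℕ → MvPolynomial ℕ ℕ
  | 0 => 1
  | j + 1 => ∑ i : Fin (j + 1), MvPolynomial.X (i : ℕ) * renewalPoly (j - i)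
  termination_by j => j
  decreasing_by omega

/-- The polynomial has natural coefficients, so two renewal sequences can be compared in mean
through the monomials in their data `b`. -/
theorem eq_aeval_renewalPoly {R : Type*} [CommSemiring R] {b c : ℕ → R} (h0 : c 0 = 1)
    (h : ∀ j, c (j + 1) = ∑ i : Fin (j + 1), b i * c (j - i)) (j : ℕ) :
    c j = MvPolynomial.aeval b (renewalPoly j) := by
  induction j using Nat.strong_induction_on with
  | _ j ih =>
    cases j with
    | zero => simp [h0, renewalPoly]
    | succ j =>
      rw [h, renewalPoly, map_sum]
      refine Finset.sum_congr rfl fun i _ => ?_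
      rw [map_mul, MvPolynomial.aeval_X, ← ih _ (by omega)]

/-- The generating polynomial of Dyck paths of length `2 * j`, where up-steps from an even level
have weight `x` and up-steps from an odd level have weight `y`. -/
def dyck {R : Type*} [CommSemiring R] : ℕ → R → R → R
  | 0, _, _ => 1
  | j + 1, x, y => ∑ i : Fin (j + 1), x * dyck i y x * dyck (j - i) x y
  termination_by j => j
  decreasing_by all_goals omega

section dyck

variable {R : Type*} [CommSemiring R]

@[simp] theorem dyck_zero (x y : R) : dyck 0 x y = 1 := by rw [dyck]

theorem dyck_succ (j : ℕ) (x y : R) :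
    dyck (j + 1) x y = ∑ i : Fin (j + 1), x * dyck i y x * dyck (j - i) x y := by rw [dyck]

theorem dyck_succ' (j : ℕ) (x y : R) :
    dyck (j + 1) x y = ∑ i ∈ Finset.range (j + 1), x * dyck i y x * dyck (j - i) x y := by
  rw [dyck_succ, Finset.sum_range]

theorem dyck_eq_aeval_renewalPoly (x y : R) (j : ℕ) :
    dyck j x y = MvPolynomial.aeval (fun i => x * dyck i y x) (renewalPoly j) :=
  eq_aeval_renewalPoly (c := fun j => dyck j x y) (dyck_zero x y) (fun j => dyck_succ j x y) j

theorem dyck_mono [PartialOrder R] [CanonicallyOrderedAdd R] [IsOrderedRing R] (j : ℕ)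
    {x x' y y' : R} (hx : x ≤ x') (hy : y ≤ y') : dyck j x y ≤ dyck j x' y' := by
  induction j using Nat.strong_induction_on generalizing x x' y y' with
  | _ j ih =>
    cases j with
    | zero => simp
    | succ j =>
      rw [dyck_succ, dyck_succ]
      gcongr with i
      · exact ih _ (by omega) hy hx
      · exact ih _ (by omega) hx hy

theorem measurable_dyck {α : Type*} [MeasurableSpace α] {f g : α → ℝ≥0∞} (j : ℕ)
    (hf : Measurable f) (hg : Measurable g) : Measurable fun a => dyck j (f a) (g a) := by
  induction j using Nat.strong_induction_on generalizing f g with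
  | _ j ih =>
    cases j with
    | zero => simp
    | succ j =>
      simp_rw [dyck_succ]
      refine Finset.measurable_sum _ fun i _ => ?_
      exact (hf.mul (ih _ (by omega) hg hf)).mul (ih _ (by omega) hf hg)

end dyck

theorem dyck_nonneg (j : ℕ) {x y : ℝ} (hx : 0 ≤ x) (hy : 0 ≤ y) : 0 ≤ dyck j x y := by
  induction j using Nat.strong_induction_on generalizing x y with
  | _ j ih =>
    cases j with
    | zero => simp
    | succ j =>
      rw [dyck_succ]
      refine Finset.sum_nonneg fun i _ => ?_
      exact mul_nonneg (mul_nonneg hx (ih _ (by omega) hy hx)) (ih _ (by omega) hx hy)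

theorem ofReal_dyck (j : ℕ) {x y : ℝ} (hx : 0 ≤ x) (hy : 0 ≤ y) :
    ENNReal.ofReal (dyck j x y) = dyck j (ENNReal.ofReal x) (ENNReal.ofReal y) := by
  induction j using Nat.strong_induction_on generalizing x y with
  | _ j ih =>
    cases j with
    | zero => simp
    | succ j =>
      rw [dyck_succ, dyck_succ, ENNReal.ofReal_sum_of_nonneg]
      · refine Finset.sum_congr rfl fun i _ => ?_
        rw [ENNReal.ofReal_mul (mul_nonneg hx (dyck_nonneg _ hy hx)), ENNReal.ofReal_mul hx,
          ih _ (by omega) hy hx, ih _ (by omega) hx hy]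
      · exact fun i _ => mul_nonneg (mul_nonneg hx (dyck_nonneg _ hy hx)) (dyck_nonneg _ hx hy)

/-- Concatenating two closed paths gives a closed path. In the first-return recursion the second
path is appended to the part after the first return. -/
theorem dyck_mul_le (j k : ℕ) {x y : ℝ} (hx : 0 ≤ x) (hy : 0 ≤ y) :
    dyck j x y * dyck k x y ≤ dyck (j + k) x y := by
  induction j using Nat.strong_induction_on with
  | _ j ih =>
    cases j with
    | zero => simp
    | succ j =>
      rw [show j + 1 + k = (j + k) + 1 by ring, dyck_succ', dyck_succ', Finset.sum_mul]
      calc _ ≤ ∑ i ∈ Finset.range (j + 1), x * dyck i y x * dyck (j + k - i) x y := by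
            refine Finset.sum_le_sum fun i hi => ?_
            have hi' : i ≤ j := by simpa [Nat.lt_succ_iff] using hi
            rw [mul_assoc, show j + k - i = (j - i) + k by omega]
            exact mul_le_mul_of_nonneg_left (ih _ (by omega)) (mul_nonneg hx (dyck_nonneg _ hy hx))
        _ ≤ _ := by
            refine Finset.sum_le_sum_of_subset_of_nonneg ?_ fun i _ _ => ?_
            · intro i hi
              simp only [Finset.mem_range] at hi ⊢
              omega
            · exact mul_nonneg (mul_nonneg hx (dyck_nonneg _ hy hx)) (dyck_nonneg _ hx hy)

theorem dyck_pow_le (m k : ℕ) {x y : ℝ} (hx : 0 ≤ x) (hy : 0 ≤ y) :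
    dyck k x y ^ m ≤ dyck (m * k) x y := by
  induction m with
  | zero => simp
  | succ m ih =>
    rw [pow_succ, add_mul, one_mul]
    exact (mul_le_mul_of_nonneg_right ih (dyck_nonneg _ hx hy)).trans (dyck_mul_le _ _ hx hy)

/-- At `s = (x + y)⁻²` the generating functions satisfy `D = 1 + x² s D' D`, where `D'` has the
weights exchanged, and `(x + y) / y`, `(x + y) / x` solve this pair of equations. The bound
therefore propagates to longer partial sums. -/
theorem sum_dyck_le (m : ℕ) {x y : ℝ} (hx : 0 < x) (hy : 0 < y) :
    ∑ j ∈ Finset.range m, dyck j (x ^ 2) (y ^ 2) * ((x + y) ^ 2)⁻¹ ^ j ≤ (x + y) / y := by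
  induction m generalizing x y with
  | zero => simp; positivity
  | succ m ih =>
    have ih1 := ih hx hy
    have ih2 := ih hy hx
    rw [add_comm y x] at ih2
    set s := ((x + y) ^ 2)⁻¹ with hs
    have hs0 : 0 ≤ s := by positivity
    have hn : ∀ j, 0 ≤ dyck j (x ^ 2) (y ^ 2) := fun j => dyck_nonneg _ (by positivity) (by positivity)
    have hn' : ∀ j, 0 ≤ dyck j (y ^ 2) (x ^ 2) := fun j => dyck_nonneg _ (by positivity) (by positivity)
    rw [Finset.sum_range_succ']
    have key : ∑ j ∈ Finset.range m, dyck (j + 1) (x ^ 2) (y ^ 2) * s ^ (j + 1) ≤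
        x ^ 2 * s * ((∑ i ∈ Finset.range m, dyck i (y ^ 2) (x ^ 2) * s ^ i) *
          ∑ i ∈ Finset.range m, dyck i (x ^ 2) (y ^ 2) * s ^ i) := by
      calc _ = x ^ 2 * s * ∑ j ∈ Finset.range m, ∑ i ∈ Finset.range (j + 1),
              (dyck i (y ^ 2) (x ^ 2) * s ^ i) * (dyck (j - i) (x ^ 2) (y ^ 2) * s ^ (j - i)) := by
            rw [Finset.mul_sum]
            refine Finset.sum_congr rfl fun j _ => ?_
            rw [dyck_succ', Finset.sum_mul, Finset.mul_sum]
            refine Finset.sum_congr rfl fun i hi => ?_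
            have hi' : i ≤ j := by simpa [Nat.lt_succ_iff] using hi
            have : s ^ (j + 1) = s * s ^ i * s ^ (j - i) := by
              rw [mul_assoc, ← pow_add, ← pow_succ']
              congr 1; omega
            rw [this]; ring
        _ ≤ _ := by
            refine mul_le_mul_of_nonneg_left ?_ (by positivity)
            rw [Finset.sum_range_diag_flip m fun i l => (dyck i (y ^ 2) (x ^ 2) * s ^ i) *
              (dyck l (x ^ 2) (y ^ 2) * s ^ l), Finset.sum_mul_sum]
            refine Finset.sum_le_sum fun i _ => Finset.sum_le_sum_of_subset_of_nonneg
              (Finset.range_subset_range.2 (Nat.sub_le m i)) fun l _ _ => ?_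
            exact mul_nonneg (mul_nonneg (hn' i) (by positivity))
              (mul_nonneg (hn l) (by positivity))
    calc _ ≤ x ^ 2 * s * (((x + y) / x) * ((x + y) / y)) + 1 := by
          refine add_le_add (key.trans ?_) (by simp)
          refine mul_le_mul_of_nonneg_left ?_ (by positivity)
          exact mul_le_mul ih2 ih1 (Finset.sum_nonneg fun i _ => mul_nonneg (hn i) (by positivity))
            (by positivity)
      _ = _ := by rw [hs]; field_simp

/-- Power trick: by `dyck_pow_le`, all powers of the ratio of the two sides occur below terms of a
series with bounded partial sums, so the ratio is at most 1. -/
theorem dyck_sq_le (k : ℕ) {x y : ℝ} (hx : 0 < x) (hy : 0 < y) :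
    dyck k (x ^ 2) (y ^ 2) ≤ (x + y) ^ (2 * k) := by
  have hpos : (0 : ℝ) < (x + y) ^ (2 * k) := by positivity
  have hn := dyck_nonneg k (sq_nonneg x) (sq_nonneg y)
  have hbd : ∀ m : ℕ, (dyck k (x ^ 2) (y ^ 2) / (x + y) ^ (2 * k)) ^ m ≤ (x + y) / y := by
    intro m
    have h1 := sum_dyck_le (m * k + 1) hx hy
    have h2 := (Finset.single_le_sum (f := fun j => dyck j (x ^ 2) (y ^ 2) * ((x + y) ^ 2)⁻¹ ^ j)
      (fun j _ => mul_nonneg (dyck_nonneg j (sq_nonneg x) (sq_nonneg y)) (by positivity))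
      (Finset.mem_range.2 (Nat.lt_succ_self (m * k)))).trans h1
    refine le_trans ?_ h2
    rw [div_pow, div_eq_mul_inv]
    refine mul_le_mul (dyck_pow_le m k (sq_nonneg x) (sq_nonneg y)) (le_of_eq ?_) (by positivity)
      (dyck_nonneg _ (sq_nonneg x) (sq_nonneg y))
    rw [inv_pow, ← pow_mul, ← pow_mul]
    congr 2; ring
  by_contra! hlt
  have h1 : 1 < dyck k (x ^ 2) (y ^ 2) / (x + y) ^ (2 * k) := (one_lt_div hpos).2 hlt
  obtain ⟨m, hm⟩ := pow_unbounded_of_one_lt ((x + y) / y) h1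
  exact absurd (hbd m) (not_le.2 hm)

/-! ### Standard Gaussian vectors and their invariances. -/

/-- The standard Gaussian measure on `ι → ℝ`. -/
noncomputable def gaussianPi (ι : Type*) [Fintype ι] : Measure (ι → ℝ) :=
  Measure.pi fun _ => gaussianReal 0 1

instance {ι : Type*} [Fintype ι] : IsProbabilityMeasure (gaussianPi ι) := by
  unfold gaussianPi; infer_instance

section gaussianPi

variable {ι κ : Type*} [Fintype ι] [Fintype κ]

theorem measurePreserving_gaussianPi_linearIsometryEquiv
    (f : EuclideanSpace ℝ ι ≃ₗᵢ[ℝ] EuclideanSpace ℝ ι) :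
    MeasurePreserving (fun x : ι → ℝ => (f (WithLp.toLp 2 x)).ofLp) (gaussianPi ι)
      (gaussianPi ι) := by
  have h1 : MeasurePreserving (WithLp.toLp 2) (gaussianPi ι)
      (stdGaussian (EuclideanSpace ℝ ι)) := ⟨by fun_prop, map_pi_eq_stdGaussian⟩
  have h2 : MeasurePreserving f (stdGaussian (EuclideanSpace ℝ ι))
      (stdGaussian (EuclideanSpace ℝ ι)) := ⟨by fun_prop, stdGaussian_map f⟩
  have h3 : MeasurePreserving (MeasurableEquiv.toLp 2 (ι → ℝ)).symm
      (stdGaussian (EuclideanSpace ℝ ι)) (gaussianPi ι) :=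
    MeasurePreserving.symm (MeasurableEquiv.toLp 2 (ι → ℝ)) h1
  exact h3.comp (h2.comp h1)

theorem measurePreserving_gaussianPi_linearMap (f : (ι → ℝ) →ₗ[ℝ] (ι → ℝ))
    (hf : ∀ x, ∑ i, f x i ^ 2 = ∑ i, x i ^ 2) :
    MeasurePreserving f (gaussianPi ι) (gaussianPi ι) := by
  let g : EuclideanSpace ℝ ι →ₗ[ℝ] EuclideanSpace ℝ ι :=
    (WithLp.linearEquiv 2 ℝ (ι → ℝ)).symm.toLinearMap ∘ₗ f ∘ₗ
      (WithLp.linearEquiv 2 ℝ (ι → ℝ)).toLinearMap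
  let gi : EuclideanSpace ℝ ι →ₗᵢ[ℝ] EuclideanSpace ℝ ι :=
    ⟨g, fun x => by
      rw [EuclideanSpace.norm_eq, EuclideanSpace.norm_eq]
      simpa [g] using congrArg Real.sqrt (hf x.ofLp)⟩
  exact measurePreserving_gaussianPi_linearIsometryEquiv (gi.toLinearIsometryEquiv rfl)

theorem measurePreserving_gaussianPi_reindex (e : ι ≃ κ) :
    MeasurePreserving (fun (x : ι → ℝ) (k : κ) => x (e.symm k)) (gaussianPi ι) (gaussianPi κ) := by
  have := measurePreserving_piCongrLeft (fun _ : κ => gaussianReal 0 1) e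
  refine (congrArg₂ (fun f μ => MeasurePreserving f μ (gaussianPi κ)) ?_ rfl).mp this
  funext x k
  obtain ⟨i, rfl⟩ := e.surjective k
  simp [MeasurableEquiv.coe_piCongrLeft]

theorem measurePreserving_gaussianPi_sum :
    MeasurePreserving (fun p : (ι → ℝ) × (κ → ℝ) => Sum.elim p.1 p.2)
      ((gaussianPi ι).prod (gaussianPi κ)) (gaussianPi (ι ⊕ κ)) := by
  have := measurePreserving_sumPiEquivProdPi_symm (fun _ : ι ⊕ κ => gaussianReal 0 1)
  refine (congrArg₂ (fun f μ => MeasurePreserving f μ (gaussianPi (ι ⊕ κ))) ?_ rfl).mp this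
  funext p k
  cases k <;> rfl

end gaussianPi

/-! ### Chi-square moments and association. -/

/-- The `d`-th moment of the squared Euclidean norm of a standard Gaussian vector in `ℝ^n`. -/
noncomputable def chiSqMoment (n d : ℕ) : ℝ≥0∞ :=
  ∫⁻ g : Fin n → ℝ, ENNReal.ofReal (∑ i, g i ^ 2) ^ d ∂gaussianPi (Fin n)

/-- Lets a law that dominates before a row is removed still dominate afterwards, so that the
induction keeps the same two laws. -/
theorem chiSqMoment_le_succ (n d : ℕ) : chiSqMoment n d ≤ chiSqMoment (n + 1) d := by
  have h1 := (measurePreserving_gaussianPi_sum (ι := Fin 1) (κ := Fin n))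
  have h2 := (measurePreserving_gaussianPi_reindex
    (finSumFinEquiv.trans (finCongr (add_comm 1 n)))).comp h1
  unfold chiSqMoment
  have hm : Measurable fun x : Fin (n + 1) → ℝ => ENNReal.ofReal (∑ i, x i ^ 2) ^ d := by fun_prop
  rw [← h2.lintegral_comp hm]
  refine le_trans ?_ (lintegral_prod _ (hm.comp h2.measurable).aemeasurable).ge
  calc _ = ∫⁻ _ : Fin 1 → ℝ, ∫⁻ g : Fin n → ℝ, ENNReal.ofReal (∑ i, g i ^ 2) ^ d
            ∂gaussianPi (Fin n) ∂gaussianPi (Fin 1) := by simp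
    _ ≤ _ := by
      refine lintegral_mono fun a => lintegral_mono fun g => ?_
      simp only [Function.comp]
      gcongr
      rw [← Equiv.sum_comp (finSumFinEquiv.trans (finCongr (add_comm 1 n)))]
      simp [Fintype.sum_sum_type]
      positivity

/-- Chebyshev's association inequality. -/
theorem lintegral_mul_lintegral_le {α : Type*} [MeasurableSpace α] [LinearOrder α]
    (ν : Measure α) [IsProbabilityMeasure ν] {f g : α → ℝ≥0∞} (hf : Monotone f) (hg : Monotone g)
    (hfm : Measurable f) (hgm : Measurable g) :
    (∫⁻ x, f x ∂ν) * ∫⁻ x, g x ∂ν ≤ ∫⁻ x, f x * g x ∂ν := by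
  -- Integrates `(f x - f y) * (g x - g y) ≥ 0` over two independent copies, rearranged to avoid
  -- subtraction in `ℝ≥0∞`.
  have h : ∫⁻ x, ∫⁻ y, (f x * g y + f y * g x) ∂ν ∂ν ≤
      ∫⁻ x, ∫⁻ y, (f x * g x + f y * g y) ∂ν ∂ν := by
    refine lintegral_mono fun x => lintegral_mono fun y => ?_
    have key : ∀ a b c d : ℝ≥0∞, a ≤ b → c ≤ d → a * d + b * c ≤ a * c + b * d := by
      intro a b c d hab hcd
      obtain ⟨p, rfl⟩ := exists_add_of_le hab
      obtain ⟨q, rfl⟩ := exists_add_of_le hcd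
      exact le_of_le_of_eq (le_self_add (b := p * q)) (by ring)
    rcases le_total x y with h | h
    · exact key _ _ _ _ (hf h) (hg h)
    · have := key _ _ _ _ (hf h) (hg h)
      rwa [add_comm, add_comm (f x * g x)]
  have e1 : ∫⁻ x, ∫⁻ y, (f x * g y + f y * g x) ∂ν ∂ν =
      2 * ((∫⁻ x, f x ∂ν) * ∫⁻ x, g x ∂ν) := by
    simp_rw [lintegral_add_left (hgm.const_mul _), lintegral_const_mul _ hgm,
      lintegral_mul_const _ hfm]
    rw [lintegral_add_left (hfm.mul_const _), lintegral_mul_const _ hfm, lintegral_const_mul _ hgm]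
    ring
  have e2 : ∫⁻ x, ∫⁻ y, (f x * g x + f y * g y) ∂ν ∂ν = 2 * ∫⁻ x, f x * g x ∂ν := by
    simp_rw [lintegral_add_left measurable_const]
    simp [two_mul]
  rw [e1, e2] at h
  exact (ENNReal.mul_le_mul_iff_right (by simp) (by simp)).1 h

/-! ### Quadratic forms of Gram matrix powers. -/

open Matrix

section quadratic

variable {n N : ℕ}

/-- The quadratic form of `(M Mᵀ) ^ j` at `u`. -/
noncomputable def gramQuad (M : Matrix (Fin n) (Fin N) ℝ) (u : Fin n → ℝ) (j : ℕ) : ℝ :=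
  u ⬝ᵥ ((M * Mᵀ) ^ j *ᵥ u)

theorem posSemidef_mul_transpose_pow (M : Matrix (Fin n) (Fin N) ℝ) (j : ℕ) :
    ((M * Mᵀ) ^ j).PosSemidef := by
  have h : (M * Mᵀ).PosSemidef := by
    simpa using Matrix.posSemidef_self_mul_conjTranspose M
  exact h.pow j

theorem gramQuad_nonneg (M : Matrix (Fin n) (Fin N) ℝ) (u : Fin n → ℝ) (j : ℕ) :
    0 ≤ gramQuad M u j := by
  simpa [gramQuad] using (posSemidef_mul_transpose_pow M j).dotProduct_mulVec_nonneg u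

theorem gramQuad_smul (M : Matrix (Fin n) (Fin N) ℝ) (a : ℝ) (u : Fin n → ℝ) (j : ℕ) :
    gramQuad M (a • u) j = a ^ 2 * gramQuad M u j := by
  simp only [gramQuad, mulVec_smul, smul_dotProduct, dotProduct_smul, smul_eq_mul]
  ring

theorem gramQuad_orthogonal (M : Matrix (Fin n) (Fin N) ℝ) (u : Fin n → ℝ) (j : ℕ)
    {O : Matrix (Fin n) (Fin n) ℝ} (hO : Oᵀ * O = 1) :
    gramQuad (O * M) (O *ᵥ u) j = gramQuad M u j := by
  have h : ∀ j, (O * M * (O * M)ᵀ) ^ j * O = O * (M * Mᵀ) ^ j := by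
    intro j
    induction j with
    | zero => simp
    | succ j ih =>
      rw [pow_succ', Matrix.mul_assoc, ih, pow_succ', Matrix.transpose_mul]
      simp only [Matrix.mul_assoc]
      rw [← Matrix.mul_assoc Oᵀ O, hO, Matrix.one_mul]
  unfold gramQuad
  rw [mulVec_mulVec, h, ← mulVec_mulVec, dotProduct_mulVec, vecMul_mulVec, hO, vecMul_one]

theorem continuous_gramQuad (u : Fin n → ℝ) (j : ℕ) :
    Continuous fun M : Matrix (Fin n) (Fin N) ℝ => gramQuad M u j := by
  unfold gramQuad
  fun_prop

/-- With `g` the first row and `W` the contribution of the other rows, `Mᵀ M = W + g gᵀ`. Expanding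
a power of it at the first occurrence of `g gᵀ` gives a renewal equation. -/
theorem gramQuad_single_succ (M : Matrix (Fin (n + 1)) (Fin N) ℝ) (j : ℕ) :
    gramQuad M (Pi.single 0 1) (j + 1) = ∑ i : Fin (j + 1),
      gramQuad (M.submatrix Fin.succ id)ᵀ (M 0) i * gramQuad M (Pi.single 0 1) (j - i) := by
  set g := M 0 with hg
  set W := (M.submatrix Fin.succ id)ᵀ * (M.submatrix Fin.succ id) with hW
  set S := Mᵀ * M with hS
  have hSW : ∀ v, S *ᵥ v = W *ᵥ v + (g ⬝ᵥ v) • g := by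
    intro v
    ext a
    simp [hS, hW, hg, mulVec, dotProduct, Matrix.mul_apply, Fin.sum_univ_succ, Finset.sum_mul,
      add_mul, Finset.sum_add_distrib]
    rw [add_comm]
    congr 1
    exact Finset.sum_congr rfl fun i _ => by ring
  have ha : ∀ j, gramQuad M (Pi.single 0 1) (j + 1) = g ⬝ᵥ (S ^ j *ᵥ g) := by
    intro j
    have h : (M * Mᵀ) ^ (j + 1) = M * S ^ j * Mᵀ := by
      induction j with
      | zero => simp
      | succ j ih => rw [pow_succ, ih, pow_succ]; simp only [hS, Matrix.mul_assoc]
    have h0 : Mᵀ *ᵥ Pi.single 0 1 = g := by ext a; simp [hg]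
    unfold gramQuad
    rw [h, ← mulVec_mulVec, ← mulVec_mulVec, h0, dotProduct_mulVec]
    congr 1
    rw [← mulVec_transpose, h0]
  have hb : ∀ i, gramQuad (M.submatrix Fin.succ id)ᵀ g i = g ⬝ᵥ (W ^ i *ᵥ g) := by
    intro i; simp [gramQuad, hW]
  -- General `i` is needed because each step turns one factor `S` into a factor `W` plus the
  -- rank-one term.
  have key : ∀ l i, g ⬝ᵥ (W ^ i *ᵥ (S ^ l *ᵥ g)) = g ⬝ᵥ (W ^ (i + l) *ᵥ g) +
      ∑ p ∈ Finset.range l, (g ⬝ᵥ (W ^ (i + p) *ᵥ g)) * (g ⬝ᵥ (S ^ (l - (p + 1)) *ᵥ g)) := by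
    intro l
    induction l with
    | zero => simp
    | succ l ih =>
      intro i
      have := ih (i + 1)
      rw [pow_succ', ← mulVec_mulVec, hSW, mulVec_add, dotProduct_add, mulVec_smul,
        dotProduct_smul, mulVec_mulVec, ← pow_succ, this, Finset.sum_range_succ']
      simp only [Nat.add_sub_add_right, zero_add, add_zero, Nat.add_sub_cancel, smul_eq_mul]
      simp only [add_assoc, add_comm 1]
      ring
  rw [ha, Fin.sum_univ_castSucc]
  have h0 := key j 0
  simp only [pow_zero, one_mulVec, zero_add] at h0
  rw [h0, add_comm]
  congr 1
  · rw [Finset.sum_range]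
    refine Finset.sum_congr rfl fun i _ => ?_
    rw [hb]
    have : j - (i.castSucc : ℕ) = (j - (i + 1)) + 1 := by have := i.2; simp; omega
    rw [this, ha]; rfl
  · rw [hb]; simp [gramQuad]

end quadratic

/-- The reflection in the hyperplane orthogonal to `e₀ - u` exchanges the two unit vectors. -/
theorem exists_orthogonal_mulVec_single {n : ℕ} (u : Fin (n + 1) → ℝ) (hu : ∑ i, u i ^ 2 = 1) :
    ∃ O : Matrix (Fin (n + 1)) (Fin (n + 1)) ℝ, Oᵀ * O = 1 ∧ O *ᵥ Pi.single 0 1 = u := by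
  let v : EuclideanSpace ℝ (Fin (n + 1)) := EuclideanSpace.single 0 1
  let w : EuclideanSpace ℝ (Fin (n + 1)) := WithLp.toLp 2 u
  have hvw : ‖v‖ = ‖w‖ := by
    simp [v, w, EuclideanSpace.norm_eq, hu]
  let R := (ℝ ∙ (v - w))ᗮ.reflection
  have hR : R v = w := Submodule.reflection_sub hvw
  let O := Matrix.toEuclideanLin.symm R.toLinearEquiv.toLinearMap
  have hO : ∀ x : EuclideanSpace ℝ (Fin (n + 1)), WithLp.toLp 2 (O *ᵥ x.ofLp) = R x := by
    intro x
    have : Matrix.toEuclideanLin O x = R x := by simp [O]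
    simpa [Matrix.toLpLin_apply] using this
  refine ⟨O, ?_, ?_⟩
  · ext i j
    have h := R.inner_map_map (EuclideanSpace.single i 1) (EuclideanSpace.single j 1)
    rw [← hO, ← hO] at h
    simp [PiLp.inner_apply] at h
    simp [Matrix.mul_apply, Matrix.one_apply]
    rw [← h]
    exact Finset.sum_congr rfl fun k _ => mul_comm _ _
  · have := congrArg WithLp.ofLp (hO v)
    rw [hR] at this
    simpa [v, w] using this

/-! ### Gaussian matrices: rotation and removal of a row. -/

/-- The matrix with entries `x (i, j)`. -/
def ofEntries {n N : ℕ} (x : Fin n × Fin N → ℝ) : Matrix (Fin n) (Fin N) ℝ :=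
  Matrix.of fun i j => x (i, j)

theorem continuous_ofEntries {n N : ℕ} :
    Continuous (ofEntries : (Fin n × Fin N → ℝ) → Matrix (Fin n) (Fin N) ℝ) := by
  unfold ofEntries
  fun_prop

section

variable {n N : ℕ}

theorem lintegral_ofEntries_mul (O : Matrix (Fin n) (Fin n) ℝ) (hO : Oᵀ * O = 1)
    (F : Matrix (Fin n) (Fin N) ℝ → ℝ≥0∞) (hF : Measurable fun x => F (ofEntries x)) :
    ∫⁻ x, F (O * ofEntries x) ∂gaussianPi (Fin n × Fin N) =
      ∫⁻ x, F (ofEntries x) ∂gaussianPi (Fin n × Fin N) := by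
  let f : (Fin n × Fin N → ℝ) →ₗ[ℝ] (Fin n × Fin N → ℝ) :=
    { toFun := fun x p => ∑ k, O p.1 k * x (k, p.2)
      map_add' := fun x y => by ext p; simp [mul_add, Finset.sum_add_distrib]
      map_smul' := fun a x => by
        ext p; simp only [Pi.smul_apply, smul_eq_mul, RingHom.id_apply, Finset.mul_sum]
        exact Finset.sum_congr rfl fun _ _ => by ring }
  have hf : MeasurePreserving f (gaussianPi _) (gaussianPi _) := by
    refine measurePreserving_gaussianPi_linearMap f fun x => ?_
    rw [Fintype.sum_prod_type_right, Fintype.sum_prod_type_right]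
    refine Finset.sum_congr rfl fun j _ => ?_
    have h : (O *ᵥ fun k => x (k, j)) ⬝ᵥ (O *ᵥ fun k => x (k, j)) =
        (fun k => x (k, j)) ⬝ᵥ fun k => x (k, j) := by
      rw [dotProduct_mulVec, vecMul_mulVec, hO, vecMul_one]
    simpa [dotProduct, mulVec, f, sq] using h
  rw [← hf.lintegral_comp hF]
  rfl

/-- The first row is independent of the rest, which is stored transposed because the induction
exchanges rows and columns. -/
theorem lintegral_ofEntries_succ (F : Matrix (Fin (n + 1)) (Fin N) ℝ → ℝ≥0∞)
    (hF : Measurable fun x => F (ofEntries x)) :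
    ∫⁻ x, F (ofEntries x) ∂gaussianPi (Fin (n + 1) × Fin N) =
      ∫⁻ g, ∫⁻ y, F (Fin.cons g (ofEntries y)ᵀ) ∂gaussianPi (Fin N × Fin n)
        ∂gaussianPi (Fin N) := by
  let e : Fin N ⊕ (Fin N × Fin n) ≃ Fin (n + 1) × Fin N :=
    { toFun := Sum.elim (fun j => (0, j)) (fun p => (p.2.succ, p.1))
      invFun := fun p => Fin.cases (Sum.inl p.2) (fun i => Sum.inr (p.2, i)) p.1
      left_inv := by rintro (j | ⟨j, i⟩) <;> rfl
      right_inv := by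
        rintro ⟨i, j⟩
        refine Fin.cases ?_ (fun i => ?_) i <;> rfl }
  have h := (measurePreserving_gaussianPi_reindex e).comp
    (measurePreserving_gaussianPi_sum (ι := Fin N) (κ := Fin N × Fin n))
  rw [← h.lintegral_comp hF]
  refine (lintegral_prod _ (hF.comp h.measurable).aemeasurable).trans ?_
  refine lintegral_congr fun g => lintegral_congr fun y => ?_
  refine congrArg F ?_
  ext i j
  refine Fin.cases ?_ (fun i => ?_) i <;> rfl

end

/-! ### Domination of Gaussian Gram moments by Dyck polynomials. -/

theorem measurable_finsuppProd_pow {α : Type*} [MeasurableSpace α] {b : α → ℕ → ℝ≥0∞}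
    (hb : ∀ i, Measurable fun a => b a i) (m : ℕ →₀ ℕ) :
    Measurable fun a => m.prod fun i e => b a i ^ e :=
  Finset.measurable_fun_prod _ fun i _ => (hb i).pow_const _

theorem measurable_aeval {α : Type*} [MeasurableSpace α] {b : α → ℕ → ℝ≥0∞}
    (hb : ∀ i, Measurable fun a => b a i) (p : MvPolynomial ℕ ℕ) :
    Measurable fun a => MvPolynomial.aeval (b a) p := by
  induction p using MvPolynomial.induction_on' with
  | monomial m c =>
    simp_rw [MvPolynomial.aeval_monomial]
    exact (measurable_finsuppProd_pow hb m).const_mul _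
  | add p q hp hq =>
    simp_rw [map_add]
    exact hp.add hq

theorem lintegral_aeval_le {α β : Type*} [MeasurableSpace α] [MeasurableSpace β] {μ : Measure α}
    {ν : Measure β} {b : α → ℕ → ℝ≥0∞} {b' : β → ℕ → ℝ≥0∞}
    (hb : ∀ i, Measurable fun a => b a i) (hb' : ∀ i, Measurable fun a => b' a i)
    (h : ∀ m : ℕ →₀ ℕ, ∫⁻ a, m.prod (fun i e => b a i ^ e) ∂μ ≤
      ∫⁻ a, m.prod (fun i e => b' a i ^ e) ∂ν) (p : MvPolynomial ℕ ℕ) :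
    ∫⁻ a, MvPolynomial.aeval (b a) p ∂μ ≤ ∫⁻ a, MvPolynomial.aeval (b' a) p ∂ν := by
  induction p using MvPolynomial.induction_on' with
  | monomial m c =>
    simp_rw [MvPolynomial.aeval_monomial]
    rw [lintegral_const_mul _ (measurable_finsuppProd_pow hb m),
      lintegral_const_mul _ (measurable_finsuppProd_pow hb' m)]
    gcongr
    exact h m
  | add p q hp hq =>
    simp_rw [map_add]
    rw [lintegral_add_left (measurable_aeval hb p), lintegral_add_left (measurable_aeval hb' p)]
    exact add_le_add hp hq

theorem measurable_gramQuad_ofEntries {n N : ℕ} (u : Fin n → ℝ) (j : ℕ) :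
    Measurable fun x : Fin n × Fin N → ℝ => ENNReal.ofReal (gramQuad (ofEntries x) u j) :=
  (((continuous_gramQuad u j).comp continuous_ofEntries).measurable).ennreal_ofReal

/-- Moments of the quadratic forms of powers of a Gaussian Gram matrix are dominated by those of
the generating polynomials of Dyck paths at independent chi-square-like variables. -/
theorem lintegral_gramQuad_le (n N : ℕ) (νX νY : Measure ℝ≥0∞) [IsProbabilityMeasure νX]
    [IsProbabilityMeasure νY] (hX : ∀ d, chiSqMoment N d ≤ ∫⁻ x, x ^ d ∂νX)
    (hY : ∀ d, chiSqMoment n d ≤ ∫⁻ y, y ^ d ∂νY) (u : Fin n → ℝ) (hu : ∑ i, u i ^ 2 = 1)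
    (m : ℕ →₀ ℕ) :
    ∫⁻ x, m.prod (fun j e => ENNReal.ofReal (gramQuad (ofEntries x) u j) ^ e)
        ∂gaussianPi (Fin n × Fin N) ≤
      ∫⁻ p, m.prod (fun j e => dyck j p.1 p.2 ^ e) ∂νX.prod νY := by
  -- The total size is the induction variable since the step swaps the dimensions. All monomials `m`
  -- are treated together, as the renewal equation turns one of them into a polynomial in the data.
  induction hs : n + N using Nat.strong_induction_on generalizing n N νX νY m with
  | _ s ih =>
  cases n with
  | zero => simp at hu
  | succ n =>
    obtain ⟨O, hO, rfl⟩ := exists_orthogonal_mulVec_single u hu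
    have hmeas : ∀ (v : Fin (n + 1) → ℝ) (m : ℕ →₀ ℕ),
        Measurable fun x : Fin (n + 1) × Fin N → ℝ =>
          m.prod (fun j e => ENNReal.ofReal (gramQuad (ofEntries x) v j) ^ e) := fun v m =>
      measurable_finsuppProd_pow (fun j => measurable_gramQuad_ofEntries v j) m
    rw [← lintegral_ofEntries_mul O hO
      (fun M => m.prod (fun j e => ENNReal.ofReal (gramQuad M (O *ᵥ Pi.single 0 1) j) ^ e))
      (hmeas _ m)]
    simp_rw [gramQuad_orthogonal _ _ _ hO]
    set b : (Fin (n + 1) × Fin N → ℝ) → ℕ → ℝ≥0∞ := fun x i => ENNReal.ofReal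
      (gramQuad ((ofEntries x).submatrix Fin.succ id)ᵀ (ofEntries x 0) i) with hb
    have hbm : ∀ i, Measurable fun x => b x i := by
      intro i
      refine Measurable.ennreal_ofReal (Continuous.measurable ?_)
      have := continuous_ofEntries (n := n + 1) (N := N)
      unfold gramQuad
      fun_prop
    have hren : ∀ x j, ENNReal.ofReal (gramQuad (ofEntries x) (Pi.single 0 1) j) =
        MvPolynomial.aeval (b x) (renewalPoly j) := by
      intro x j
      refine eq_aeval_renewalPoly
        (c := fun j => ENNReal.ofReal (gramQuad (ofEntries x) (Pi.single 0 1) j)) ?_ ?_ j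
      · simp [gramQuad]
      · intro j
        simp only [hb]
        rw [gramQuad_single_succ, ENNReal.ofReal_sum_of_nonneg fun i _ =>
          mul_nonneg (gramQuad_nonneg _ _ _) (gramQuad_nonneg _ _ _)]
        exact Finset.sum_congr rfl fun i _ => ENNReal.ofReal_mul (gramQuad_nonneg _ _ _)
    have hcomp : ∀ c : ℕ → ℝ≥0∞,
        m.prod (fun j e => MvPolynomial.aeval c (renewalPoly j) ^ e) =
          MvPolynomial.aeval c (m.prod fun j e => renewalPoly j ^ e) := by
      intro c
      simp [Finsupp.prod, map_prod, map_pow]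
    have hdyck : ∀ q : ℝ≥0∞ × ℝ≥0∞, m.prod (fun j e => dyck j q.1 q.2 ^ e) =
        MvPolynomial.aeval (fun i => q.1 * dyck i q.2 q.1)
          (m.prod fun j e => renewalPoly j ^ e) := by
      intro q
      rw [← hcomp]
      exact Finset.prod_congr rfl fun j _ =>
        congrArg (· ^ m j) (dyck_eq_aeval_renewalPoly q.1 q.2 j)
    simp_rw [hren, hdyck, hcomp]
    refine lintegral_aeval_le hbm (fun i => measurable_fst.mul
      (measurable_dyck i measurable_snd measurable_fst)) (fun m => ?_) _
    have hsplit : ∀ (a : ℝ≥0∞) (c : ℕ → ℝ≥0∞), m.prod (fun i e => (a * c i) ^ e) =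
        a ^ (m.sum fun _ e => e) * m.prod fun i e => c i ^ e := by
      intro a c
      simp [Finsupp.prod, Finsupp.sum, mul_pow, Finset.prod_mul_distrib,
        Finset.prod_pow_eq_pow_sum]
    set d := m.sum fun _ e => e with hd
    set K := ∫⁻ q, m.prod (fun j e => dyck j q.1 q.2 ^ e) ∂νY.prod νX with hK
    -- For fixed `g`, normalising pulls out `|g|²` from each of the `d` factors, and the induction
    -- hypothesis applies to the smaller matrix with the two laws exchanged. For `g = 0` a
    -- nonconstant monomial vanishes.
    have hinner : ∀ g : Fin N → ℝ,
        ∫⁻ y, m.prod (fun i e => ENNReal.ofReal (gramQuad (ofEntries y) g i) ^ e)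
          ∂gaussianPi (Fin N × Fin n) ≤ ENNReal.ofReal (∑ i, g i ^ 2) ^ d * K := by
      intro g
      rcases eq_or_ne m 0 with rfl | hm
      · simp [hK, hd]
      rcases (Finset.sum_nonneg fun i _ => sq_nonneg (g i) :
        0 ≤ ∑ i, g i ^ 2).eq_or_lt with h0 | h0
      · have hg : g = 0 := by
          ext i
          have := (Finset.sum_eq_zero_iff_of_nonneg fun i _ => sq_nonneg (g i)).1 h0.symm i
          simpa using this
        obtain ⟨i, hi⟩ := Finsupp.ne_iff.1 hm
        have hz : ∀ y : Fin N × Fin n → ℝ,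
            m.prod (fun i e => ENNReal.ofReal (gramQuad (ofEntries y) g i) ^ e) = 0 := by
          intro y
          refine Finset.prod_eq_zero (Finsupp.mem_support_iff.2 hi) ?_
          have : m i ≠ 0 := hi
          simp [hg, gramQuad, this]
        simp [hz]
      · set a := Real.sqrt (∑ i, g i ^ 2) with ha
        have ha0 : a ≠ 0 := (Real.sqrt_pos.2 h0).ne'
        have ha2 : a ^ 2 = ∑ i, g i ^ 2 := Real.sq_sqrt h0.le
        have hgu : g = a • (a⁻¹ • g) := by rw [smul_smul, mul_inv_cancel₀ ha0, one_smul]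
        have hscale : ∀ (y : Fin N × Fin n → ℝ) (i : ℕ),
            ENNReal.ofReal (gramQuad (ofEntries y) g i) = ENNReal.ofReal (∑ i, g i ^ 2) *
              ENNReal.ofReal (gramQuad (ofEntries y) (a⁻¹ • g) i) := by
          intro y i
          rw [← ENNReal.ofReal_mul h0.le, ← ha2, ← gramQuad_smul, ← hgu]
        simp_rw [hscale, hsplit]
        rw [lintegral_const_mul _ (measurable_finsuppProd_pow
          (fun j => measurable_gramQuad_ofEntries (a⁻¹ • g) j) m)]
        gcongr
        refine ih (N + n) (by omega) N n νY νX (fun d => (chiSqMoment_le_succ n d).trans (hY d)) hX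
          (a⁻¹ • g) ?_ m rfl
        simp only [Pi.smul_apply, smul_eq_mul, mul_pow, ← Finset.mul_sum]
        rw [← ha2, ← mul_pow, inv_mul_cancel₀ ha0, one_pow]
    have hm2 : Measurable fun q : ℝ≥0∞ × ℝ≥0∞ => m.prod (fun j e => dyck j q.1 q.2 ^ e) :=
      measurable_finsuppProd_pow (fun j => measurable_dyck j measurable_fst measurable_snd) m
    have hm3 : Measurable fun q : ℝ≥0∞ × ℝ≥0∞ => m.prod (fun j e => dyck j q.2 q.1 ^ e) :=
      measurable_finsuppProd_pow (fun j => measurable_dyck j measurable_snd measurable_fst) m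
    have hmono : Monotone fun x : ℝ≥0∞ => ∫⁻ y, m.prod (fun j e => dyck j y x ^ e) ∂νY := by
      intro x x' hx
      refine lintegral_mono fun y => Finset.prod_le_prod' fun i _ => ?_
      exact pow_le_pow_left' (dyck_mono i le_rfl hx) _
    calc ∫⁻ x, m.prod (fun i e => b x i ^ e) ∂gaussianPi (Fin (n + 1) × Fin N)
        = ∫⁻ g, ∫⁻ y, m.prod (fun i e => ENNReal.ofReal (gramQuad (ofEntries y) g i) ^ e)
            ∂gaussianPi (Fin N × Fin n) ∂gaussianPi (Fin N) :=
          lintegral_ofEntries_succ (fun M => m.prod fun i e => ENNReal.ofReal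
            (gramQuad (M.submatrix Fin.succ id)ᵀ (M 0) i) ^ e)
            (measurable_finsuppProd_pow hbm m)
      _ ≤ ∫⁻ g : Fin N → ℝ, ENNReal.ofReal (∑ i, g i ^ 2) ^ d * K ∂gaussianPi (Fin N) :=
          lintegral_mono hinner
      _ = chiSqMoment N d * K := lintegral_mul_const _ (by fun_prop)
      _ ≤ (∫⁻ x, x ^ d ∂νX) * K := by gcongr; exact hX d
      _ = (∫⁻ x, x ^ d ∂νX) * ∫⁻ x, ∫⁻ y, m.prod (fun j e => dyck j y x ^ e) ∂νY ∂νX := by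
          rw [hK, lintegral_prod_symm _ hm2.aemeasurable]
      -- The weight of the removed row and the weight `x` inside the Dyck polynomials, independent
      -- so far, become one variable; both factors increase in `x`.
      _ ≤ ∫⁻ x, x ^ d * ∫⁻ y, m.prod (fun j e => dyck j y x ^ e) ∂νY ∂νX :=
          lintegral_mul_lintegral_le νX (fun x y h => pow_le_pow_left' h d) hmono
            (by fun_prop) hm3.lintegral_prod_right'
      _ = ∫⁻ q, q.1 ^ d * m.prod (fun j e => dyck j q.2 q.1 ^ e) ∂νX.prod νY := by
          refine Eq.trans ?_
            (lintegral_prod _ ((measurable_fst.pow_const d).mul hm3).aemeasurable).symm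
          refine lintegral_congr fun x => ?_
          exact (lintegral_const_mul _ (hm3.comp measurable_prodMk_left)).symm
      _ = _ := lintegral_congr fun q => (hsplit _ _).symm

/-! ### Exponential moments and the Gaussian trace bound. -/

theorem integral_exp_mul_sq_sub_one_gaussianReal {l : ℝ} (hl : l < 1 / 2) :
    ∫ x, Real.exp (l * (x ^ 2 - 1)) ∂gaussianReal 0 1 =
      Real.exp (-l) * (Real.sqrt (1 - 2 * l))⁻¹ := by
  rw [integral_gaussianReal_eq_integral_smul one_ne_zero]
  have h : ∀ x : ℝ, gaussianPDFReal 0 1 x • Real.exp (l * (x ^ 2 - 1)) =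
      ((Real.sqrt (2 * Real.pi))⁻¹ * Real.exp (-l)) * Real.exp (-(1 / 2 - l) * x ^ 2) := by
    intro x
    have e : Real.exp (-(x - 0) ^ 2 / (2 * 1)) * Real.exp (l * (x ^ 2 - 1)) =
        Real.exp (-l) * Real.exp (-(1 / 2 - l) * x ^ 2) := by
      rw [← Real.exp_add, ← Real.exp_add]
      ring_nf
    rw [gaussianPDFReal, smul_eq_mul, NNReal.coe_one, mul_assoc, e, mul_one, mul_assoc]
  simp_rw [h]
  rw [integral_const_mul, integral_gaussian]
  have : Real.pi / (1 / 2 - l) = (2 * Real.pi) * (1 - 2 * l)⁻¹ := by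
    have : 1 / 2 - l ≠ 0 := by linarith
    have : 1 - 2 * l ≠ 0 := by linarith
    field_simp
  rw [this, Real.sqrt_mul (x := 2 * Real.pi) (by positivity), Real.sqrt_inv]
  have : Real.sqrt (2 * Real.pi) ≠ 0 := (Real.sqrt_pos.2 (by positivity)).ne'
  field_simp

theorem integrable_exp_mul_sq_sub_one_gaussianReal {l : ℝ} (hl : l < 1 / 2) :
    Integrable (fun x => Real.exp (l * (x ^ 2 - 1))) (gaussianReal 0 1) := by
  refine Integrable.of_integral_ne_zero ?_
  rw [integral_exp_mul_sq_sub_one_gaussianReal hl]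
  have : 0 < Real.sqrt (1 - 2 * l) := Real.sqrt_pos.2 (by linarith)
  positivity

/-- After squaring, the claim is `1 ≤ (1 - 2l) exp (2l + 4l²)`. The quadratic lower bound for `exp`
suffices, the excess over 1 being a sum of nonnegative terms when `l ≤ 1/4`. -/
theorem integral_exp_mul_sq_sub_one_gaussianReal_le {l : ℝ} (h0 : 0 ≤ l) (hl : l ≤ 1 / 4) :
    ∫ x, Real.exp (l * (x ^ 2 - 1)) ∂gaussianReal 0 1 ≤ Real.exp (2 * l ^ 2) := by
  rw [integral_exp_mul_sq_sub_one_gaussianReal (by linarith)]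
  have h1 : 0 < 1 - 2 * l := by linarith
  have hq := Real.quadratic_le_exp_of_nonneg (x := 2 * l + 4 * l ^ 2) (by positivity)
  have h2 : 1 ≤ (1 - 2 * l) * Real.exp (2 * l + 4 * l ^ 2) := by
    have h3 : (1 - 2 * l) * (1 + (2 * l + 4 * l ^ 2) + (2 * l + 4 * l ^ 2) ^ 2 / 2) =
        1 + 2 * l ^ 2 * ((1 - 4 * l) * (1 + 2 * l)) + 8 * l ^ 4 * (1 - 2 * l) := by ring
    have h4 : 0 ≤ 2 * l ^ 2 * ((1 - 4 * l) * (1 + 2 * l)) :=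
      mul_nonneg (by positivity) (mul_nonneg (by linarith) (by linarith))
    have h5 : 0 ≤ 8 * l ^ 4 * (1 - 2 * l) := mul_nonneg (by positivity) h1.le
    nlinarith [mul_le_mul_of_nonneg_left hq h1.le]
  have hs : 0 < Real.sqrt (1 - 2 * l) := Real.sqrt_pos.2 h1
  have h3 : 1 ≤ Real.sqrt (1 - 2 * l) * Real.exp (l + 2 * l ^ 2) := by
    rw [← Real.sqrt_one]
    refine Real.sqrt_le_iff.2 ⟨by positivity, ?_⟩
    rw [mul_pow, Real.sq_sqrt (by simpa using h1.le), ← Real.exp_nat_mul]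
    simpa [mul_add, ← mul_assoc, show (2 : ℝ) * 2 = 4 by norm_num] using h2
  rw [← div_eq_mul_inv, div_le_iff₀ hs]
  calc Real.exp (-l) ≤ Real.exp (-l) * (Real.sqrt (1 - 2 * l) * Real.exp (l + 2 * l ^ 2)) :=
        le_mul_of_one_le_right (Real.exp_pos _).le h3
    _ = _ := by
        rw [mul_left_comm, ← Real.exp_add]
        ring_nf

theorem lintegral_exp_mul_normSq_sub_le (n : ℕ) {l : ℝ} (h0 : 0 ≤ l) (hl : l ≤ 1 / 4) :
    ∫⁻ g : Fin n → ℝ, ENNReal.ofReal (Real.exp (l * (∑ i, g i ^ 2 - n))) ∂gaussianPi (Fin n) ≤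
      ENNReal.ofReal (Real.exp (2 * l ^ 2 * n)) := by
  have h : ∀ g : Fin n → ℝ, Real.exp (l * (∑ i, g i ^ 2 - n)) =
      ∏ i, Real.exp (l * (g i ^ 2 - 1)) := by
    intro g
    rw [← Real.exp_sum, ← Finset.mul_sum, Finset.sum_sub_distrib]
    simp
  simp_rw [h]
  have hint : Integrable (fun g : Fin n → ℝ => ∏ i, Real.exp (l * (g i ^ 2 - 1)))
      (gaussianPi (Fin n)) :=
    Integrable.fintype_prod fun _ => integrable_exp_mul_sq_sub_one_gaussianReal (by linarith)
  rw [← ofReal_integral_eq_lintegral_ofReal hint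
    (Filter.Eventually.of_forall fun g => by positivity)]
  refine ENNReal.ofReal_le_ofReal ?_
  unfold gaussianPi
  rw [integral_fintype_prod_eq_prod (fun (_ : Fin n) x => Real.exp (l * (x ^ 2 - 1)))]
  rw [Finset.prod_const, Finset.card_univ, Fintype.card_fin, mul_comm _ (n : ℝ), Real.exp_nat_mul]
  refine pow_le_pow_left₀ (integral_nonneg fun x => (Real.exp_pos _).le) ?_ _
  exact integral_exp_mul_sq_sub_one_gaussianReal_le h0 hl

/-- AM-GM linearises the roots, `√X ≤ (X + N) / (2√N)` and likewise for `Y`; then `1 + δ ≤ exp δ`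
separates the two variables. -/
theorem dyck_le_mul_exp {n N X Y : ℝ} (hn : 0 < n) (hN : 0 < N) (hX : 0 ≤ X) (hY : 0 ≤ Y)
    (k : ℕ) :
    dyck k X Y ≤ (Real.sqrt N + Real.sqrt n) ^ (2 * k) *
      (Real.exp (k / ((Real.sqrt N + Real.sqrt n) * Real.sqrt N) * (X - N)) *
        Real.exp (k / ((Real.sqrt N + Real.sqrt n) * Real.sqrt n) * (Y - n))) := by
  set a := Real.sqrt N with ha
  set b := Real.sqrt n with hb
  have ha0 : 0 < a := Real.sqrt_pos.2 hN
  have hb0 : 0 < b := Real.sqrt_pos.2 hn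
  have ha2 : N = a ^ 2 := (Real.sq_sqrt hN.le).symm
  have hb2 : n = b ^ 2 := (Real.sq_sqrt hn.le).symm
  rw [ha2, hb2]
  have hamgm : ∀ {c Z : ℝ}, 0 < c → Z ≤ ((Z + c ^ 2) / (2 * c)) ^ 2 := by
    intro c Z hc
    rw [div_pow, le_div_iff₀ (by positivity)]
    nlinarith [sq_nonneg (Z - c ^ 2)]
  set s := (X + a ^ 2) / (2 * a) with hs
  set t := (Y + b ^ 2) / (2 * b) with ht
  have hs0 : 0 < s := by positivity
  have ht0 : 0 < t := by positivity
  -- `dyck_mono` asks for a canonical order, hence the passage through `ℝ≥0∞`.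
  have h1 : dyck k X Y ≤ dyck k (s ^ 2) (t ^ 2) := by
    refine (ENNReal.ofReal_le_ofReal_iff (dyck_nonneg _ (sq_nonneg s) (sq_nonneg t))).1 ?_
    rw [ofReal_dyck k hX hY, ofReal_dyck k (sq_nonneg s) (sq_nonneg t)]
    exact dyck_mono k (ENNReal.ofReal_le_ofReal (hamgm ha0))
      (ENNReal.ofReal_le_ofReal (hamgm hb0))
  refine (h1.trans (dyck_sq_le k hs0 ht0)).trans ?_
  set δ := ((X - a ^ 2) / (2 * a) + (Y - b ^ 2) / (2 * b)) / (a + b) with hδ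
  have h2 : s + t = (a + b) * (1 + δ) := by
    rw [hs, ht, hδ]; field_simp; ring
  have h3 : s + t ≤ (a + b) * Real.exp δ := by
    rw [h2]
    exact mul_le_mul_of_nonneg_left (by linarith [Real.add_one_le_exp δ]) (by positivity)
  calc (s + t) ^ (2 * k) ≤ ((a + b) * Real.exp δ) ^ (2 * k) :=
        pow_le_pow_left₀ (by positivity) h3 _
    _ = _ := by
        rw [mul_pow, ← Real.exp_nat_mul, ← Real.exp_add]
        congr 2
        rw [hδ]; push_cast; field_simp

theorem gramQuad_single {n N : ℕ} (M : Matrix (Fin n) (Fin N) ℝ) (i : Fin n) (k : ℕ) :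
    gramQuad M (Pi.single i 1) k = ((M * Mᵀ) ^ k) i i := by
  simp [gramQuad]

theorem lintegral_trace_gram_pow_le {n N k : ℕ} (hn : 1 ≤ n) (hnN : n ≤ N)
    (hk : (k : ℝ) ≤ 1 / 4 * Real.sqrt N) :
    ∫⁻ x, ENNReal.ofReal (trace ((ofEntries x * (ofEntries x)ᵀ) ^ k))
        ∂gaussianPi (Fin n × Fin N) ≤
      ENNReal.ofReal (2 * n * (Real.sqrt N + Real.sqrt n) ^ (2 * k)) := by
  have hn0 : (0 : ℝ) < n := by exact_mod_cast hn
  have hN0 : (0 : ℝ) < N := by exact_mod_cast hn.trans hnN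
  have hmeasX : ∀ m : ℕ, Measurable fun g : Fin m → ℝ => ENNReal.ofReal (∑ i, g i ^ 2) :=
    fun m => by fun_prop
  let ν : ℕ → Measure ℝ≥0∞ := fun m =>
    (gaussianPi (Fin m)).map fun g => ENNReal.ofReal (∑ i, g i ^ 2)
  have hν : ∀ m, IsProbabilityMeasure (ν m) := fun m =>
    Measure.isProbabilityMeasure_map (hmeasX m).aemeasurable
  have hmom : ∀ m d, chiSqMoment m d ≤ ∫⁻ x, x ^ d ∂ν m := by
    intro m d
    rw [lintegral_map (by fun_prop) (hmeasX m)]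
    rfl
  set A := Real.sqrt N + Real.sqrt n with hA
  have hsN : 0 < Real.sqrt N := Real.sqrt_pos.2 hN0
  have hsn : 0 < Real.sqrt n := Real.sqrt_pos.2 hn0
  have hsn1 : 1 ≤ Real.sqrt n := Real.one_le_sqrt.2 (by exact_mod_cast hn)
  have hsN1 : 1 ≤ Real.sqrt N := Real.one_le_sqrt.2 (by exact_mod_cast hn.trans hnN)
  have hA0 : 0 < A := by positivity
  have hkA : (k : ℝ) / A ≤ 1 / 4 := by
    rw [div_le_iff₀ hA0]; linarith
  set l₁ := (k : ℝ) / (A * Real.sqrt N) with hl₁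
  set l₂ := (k : ℝ) / (A * Real.sqrt n) with hl₂
  have hl₁0 : 0 ≤ l₁ := by positivity
  have hl₂0 : 0 ≤ l₂ := by positivity
  have hl₁4 : l₁ ≤ 1 / 4 := by
    rw [hl₁, ← div_div]; exact (div_le_self (by positivity) hsN1).trans hkA
  have hl₂4 : l₂ ≤ 1 / 4 := by
    rw [hl₂, ← div_div]; exact (div_le_self (by positivity) hsn1).trans hkA
  have hdyck : ∫⁻ q, dyck k q.1 q.2 ∂(ν N).prod (ν n) ≤ ENNReal.ofReal (2 * A ^ (2 * k)) := by
    have hm : Measurable fun q : ℝ≥0∞ × ℝ≥0∞ => dyck k q.1 q.2 :=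
      measurable_dyck k measurable_fst measurable_snd
    rw [lintegral_prod _ hm.aemeasurable, lintegral_map hm.lintegral_prod_right' (hmeasX N)]
    have hinner : ∀ g : Fin N → ℝ, ∫⁻ y, dyck k (ENNReal.ofReal (∑ i, g i ^ 2)) y ∂ν n ≤
        ENNReal.ofReal (A ^ (2 * k)) *
          (ENNReal.ofReal (Real.exp (l₁ * (∑ i, g i ^ 2 - N))) *
          ENNReal.ofReal (Real.exp (2 * l₂ ^ 2 * n))) := by
      intro g
      refine (lintegral_map (hm.comp measurable_prodMk_left) (hmeasX n)).trans_le ?_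
      refine le_trans ?_ (mul_le_mul_right (mul_le_mul_right
        (lintegral_exp_mul_normSq_sub_le n hl₂0 hl₂4) _) _)
      rw [← lintegral_const_mul _ (by fun_prop), ← lintegral_const_mul _ (by fun_prop)]
      refine lintegral_mono fun h => ?_
      have hX : 0 ≤ ∑ i, g i ^ 2 := Finset.sum_nonneg fun i _ => sq_nonneg _
      have hY : 0 ≤ ∑ i, h i ^ 2 := Finset.sum_nonneg fun i _ => sq_nonneg _
      refine (ofReal_dyck k hX hY).symm.trans_le ?_
      rw [← ENNReal.ofReal_mul (Real.exp_pos _).le,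
        ← ENNReal.ofReal_mul (by positivity)]
      exact ENNReal.ofReal_le_ofReal (dyck_le_mul_exp hn0 hN0 hX hY k)
    refine (lintegral_mono hinner).trans ?_
    rw [lintegral_const_mul _ (by fun_prop), lintegral_mul_const _ (by fun_prop)]
    refine (mul_le_mul_right (mul_le_mul_left
        (lintegral_exp_mul_normSq_sub_le N hl₁0 hl₁4) _) _).trans ?_
    rw [← ENNReal.ofReal_mul (Real.exp_pos _).le, ← ENNReal.ofReal_mul (by positivity),
      ← Real.exp_add, mul_comm]
    refine ENNReal.ofReal_le_ofReal (mul_le_mul_of_nonneg_right ?_ (by positivity))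
    -- Both tilts contribute `2 * (k / A) ^ 2`. As `k / A ≤ 1/4`, the total is below `1/2`, and `exp
    -- (1/2) ≤ 2` is the source of the factor 2.
    have e1 : 2 * l₁ ^ 2 * N + 2 * l₂ ^ 2 * n = 4 * (k / A) ^ 2 := by
      have h1 : l₁ ^ 2 * N = (k / A) ^ 2 := by
        rw [hl₁, ← div_div, div_pow _ (Real.sqrt _), Real.sq_sqrt hN0.le]; field_simp
      have h2 : l₂ ^ 2 * n = (k / A) ^ 2 := by
        rw [hl₂, ← div_div, div_pow _ (Real.sqrt _), Real.sq_sqrt hn0.le]; field_simp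
      linear_combination 2 * h1 + 2 * h2
    rw [e1]
    have e2 : 4 * ((k : ℝ) / A) ^ 2 ≤ 1 / 2 := by
      have : (0 : ℝ) ≤ k / A := by positivity
      nlinarith
    refine (Real.exp_le_exp.2 e2).trans ?_
    have := Real.exp_one_lt_d9
    have h3 : Real.exp (1 / 2) ^ 2 = Real.exp 1 := by rw [← Real.exp_nat_mul]; norm_num
    nlinarith [Real.exp_pos (1 / 2)]
  have hentry : ∀ i : Fin n, ∫⁻ x, ENNReal.ofReal (gramQuad (ofEntries x) (Pi.single i 1) k)
      ∂gaussianPi (Fin n × Fin N) ≤ ENNReal.ofReal (2 * A ^ (2 * k)) := by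
    intro i
    have hu : ∑ j, (Pi.single i 1 : Fin n → ℝ) j ^ 2 = 1 := by
      simp [Pi.single_apply]
    have := lintegral_gramQuad_le n N (ν N) (ν n) (hmom N) (hmom n) (Pi.single i 1) hu
      (Finsupp.single k 1)
    simp only [Finsupp.prod_single_index, pow_zero, pow_one] at this
    exact this.trans hdyck
  have htr : ∀ x : Fin n × Fin N → ℝ,
      ENNReal.ofReal (trace ((ofEntries x * (ofEntries x)ᵀ) ^ k)) =
        ∑ i, ENNReal.ofReal (gramQuad (ofEntries x) (Pi.single i 1) k) := by
    intro x
    rw [← ENNReal.ofReal_sum_of_nonneg fun i _ => gramQuad_nonneg _ _ _]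
    simp [trace, gramQuad_single]
  simp_rw [htr]
  rw [lintegral_finsetSum _ fun i _ => measurable_gramQuad_ofEntries _ _]
  refine (Finset.sum_le_sum fun i _ => hentry i).trans ?_
  rw [Finset.sum_const, Finset.card_univ, Fintype.card_fin, nsmul_eq_mul,
    ← ENNReal.ofReal_natCast, ← ENNReal.ofReal_mul (by positivity)]
  exact ENNReal.ofReal_le_ofReal (le_of_eq (by ring))

/-! ### Comparison of signs with Gaussians. -/

theorem integrable_pow_gaussianReal (m : ℕ) :
    Integrable (fun x : ℝ => x ^ m) (gaussianReal 0 1) := by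
  have h := memLp_id_gaussianReal (μ := 0) (v := 1) (m : NNReal)
  have h1 := h.integrable_norm_pow'
  refine (integrable_norm_iff (by fun_prop)).1 ?_
  simpa using h1

theorem integral_pow_gaussianReal_of_odd {m : ℕ} (hm : Odd m) :
    ∫ x, x ^ m ∂gaussianReal 0 1 = 0 := by
  have h : (gaussianReal 0 1).map (fun x => -x) = gaussianReal 0 1 := by
    rw [gaussianReal_map_neg]; simp
  have h1 : ∫ x, x ^ m ∂gaussianReal 0 1 = ∫ x, (-x) ^ m ∂gaussianReal 0 1 := by
    conv_lhs => rw [← h]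
    rw [integral_map (by fun_prop) (by fun_prop)]
  simp_rw [hm.neg_pow, integral_neg] at h1
  linarith

/-- Bernoulli's inequality gives `x ^ (2 * r) ≥ 1 + r * (x ^ 2 - 1)`, whose right side has mean 1.
-/
theorem one_le_integral_pow_gaussianReal_of_even {m : ℕ} (hm : Even m) :
    1 ≤ ∫ x, x ^ m ∂gaussianReal 0 1 := by
  obtain ⟨r, rfl⟩ := hm
  have h2 : ∫ x : ℝ, x ^ 2 ∂gaussianReal 0 1 = 1 := by
    have h := variance_fun_id_gaussianReal (μ := 0) (v := 1)
    rw [variance_eq_integral (by fun_prop)] at h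
    simpa [integral_id_gaussianReal] using h
  have h3 : ∫ x : ℝ, (1 + r * (x ^ 2 - 1)) ∂gaussianReal 0 1 = 1 := by
    have hi : Integrable (fun x : ℝ => x ^ 2) (gaussianReal 0 1) := integrable_pow_gaussianReal 2
    have hi' : Integrable (fun x : ℝ => x ^ 2 - 1) (gaussianReal 0 1) :=
      hi.sub (integrable_const _)
    rw [integral_add (integrable_const _) (hi'.const_mul _),
      integral_const_mul, integral_sub hi (integrable_const _), h2]
    simp
  calc 1 = ∫ x : ℝ, (1 + r * (x ^ 2 - 1)) ∂gaussianReal 0 1 := h3.symm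
    _ ≤ _ := by
      refine integral_mono ?_ (integrable_pow_gaussianReal _) fun x => ?_
      · exact (integrable_const _).add
          (((integrable_pow_gaussianReal 2).sub (integrable_const _)).const_mul _)
      · have := one_add_mul_le_pow (a := x ^ 2 - 1) (by nlinarith [sq_nonneg x]) r
        simpa [← pow_mul, two_mul] using this

section signs

variable {Ω σ : Type*} [MeasurableSpace Ω] {μ : Measure Ω} [IsProbabilityMeasure μ]

theorem ae_eq_one_or_neg_one {X : Ω → ℝ} (hX : Measurable X) (h1 : μ {ω | X ω = 1} = 1 / 2)
    (h2 : μ {ω | X ω = -1} = 1 / 2) : ∀ᵐ ω ∂μ, X ω = 1 ∨ X ω = -1 := by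
  have hm1 : MeasurableSet {ω | X ω = 1} := hX (measurableSet_singleton 1)
  have hm2 : MeasurableSet {ω | X ω = -1} := hX (measurableSet_singleton (-1))
  have hd : Disjoint {ω | X ω = 1} {ω | X ω = -1} := by
    rw [Set.disjoint_left]
    intro ω h h'
    simp only [Set.mem_ofPred_eq] at h h'
    linarith
  have hu : μ ({ω | X ω = 1} ∪ {ω | X ω = -1}) = 1 := by
    rw [measure_union hd hm2, h1, h2, ENNReal.add_halves]
  exact (prob_compl_eq_zero_iff (hm1.union hm2)).2 hu

theorem integral_sign_pow {X : Ω → ℝ} (hX : Measurable X) (h1 : μ {ω | X ω = 1} = 1 / 2)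
    (h2 : μ {ω | X ω = -1} = 1 / 2) (m : ℕ) :
    ∫ ω, X ω ^ m ∂μ = if Even m then 1 else 0 := by
  have hae := ae_eq_one_or_neg_one hX h1 h2
  split_ifs with hm
  · have : ∀ᵐ ω ∂μ, X ω ^ m = 1 := by
      filter_upwards [hae] with ω h
      rcases h with h | h <;> simp [h, hm.neg_one_pow]
    rw [integral_congr_ae this]
    simp
  · have hm' : Odd m := Nat.not_even_iff_odd.1 hm
    have hm1 : MeasurableSet {ω | X ω = 1} := hX (measurableSet_singleton 1)
    have hm2 : MeasurableSet {ω | X ω = -1} := hX (measurableSet_singleton (-1))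
    have : ∀ᵐ ω ∂μ, X ω ^ m = {ω | X ω = 1}.indicator (fun _ => (1 : ℝ)) ω -
        {ω | X ω = -1}.indicator (fun _ => (1 : ℝ)) ω := by
      filter_upwards [hae] with ω h
      rcases h with h | h <;> simp [h, hm'.neg_one_pow, Set.indicator] <;> norm_num
    rw [integral_congr_ae this, integral_sub ((integrable_const _).indicator hm1)
      ((integrable_const _).indicator hm2), integral_indicator_const _ hm1,
      integral_indicator_const _ hm2]
    simp [Measure.real, h1, h2]

theorem integral_sign_pow_le {X : Ω → ℝ} (hX : Measurable X) (h1 : μ {ω | X ω = 1} = 1 / 2)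
    (h2 : μ {ω | X ω = -1} = 1 / 2) (m : ℕ) :
    ∫ ω, X ω ^ m ∂μ ≤ ∫ x, x ^ m ∂gaussianReal 0 1 := by
  rw [integral_sign_pow hX h1 h2]
  split_ifs with hm
  · exact one_le_integral_pow_gaussianReal_of_even hm
  · rw [integral_pow_gaussianReal_of_odd (Nat.not_even_iff_odd.1 hm)]

variable [Fintype σ]

theorem integrable_monomial_gaussianPi (m : σ →₀ ℕ) :
    Integrable (fun x : σ → ℝ => ∏ i, x i ^ m i) (gaussianPi σ) :=
  Integrable.fintype_prod (f := fun i x => x ^ m i) fun i => integrable_pow_gaussianReal (m i)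

variable {K : ℕ} {X : σ → Ω → ℝ}

theorem IsKWiseIndependentRandomSigns.integrable_monomial
    (hX : IsKWiseIndependentRandomSigns K X μ) (m : σ →₀ ℕ) :
    Integrable (fun ω => ∏ i, X i ω ^ m i) μ := by
  refine Integrable.of_bound (C := 1) ?_ ?_
  · exact (Finset.measurable_fun_prod _ fun i _ => (hX.measurable i).pow_const _).aestronglyMeasurable
  · have : ∀ᵐ ω ∂μ, ∀ i, X i ω = 1 ∨ X i ω = -1 := ae_all_iff.2 fun i =>
      ae_eq_one_or_neg_one (hX.measurable i) (hX.prob_one i) (hX.prob_neg_one i)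
    filter_upwards [this] with ω h
    rw [norm_prod]
    refine Finset.prod_le_one (fun i _ => norm_nonneg _) fun i _ => ?_
    rcases h i with h | h <;> simp [h]

/-- Independence is given only for sets of exactly `K` indices, so the support of `m` is enlarged to
such a set; this is what `hK` permits. -/
theorem IsKWiseIndependentRandomSigns.integral_monomial_le
    (hX : IsKWiseIndependentRandomSigns K X μ) (hK : K ≤ Fintype.card σ) {m : σ →₀ ℕ}
    (hm : m.support.card ≤ K) :
    ∫ ω, ∏ i, X i ω ^ m i ∂μ ≤ ∫ x, ∏ i, x i ^ m i ∂gaussianPi σ := by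
  obtain ⟨S, hS, hcard⟩ := Finset.exists_superset_card_eq hm hK
  have hind := hX.kWiseIndependent S hcard
  have hprod : ∀ f : σ → ℝ, (∀ i, m i = 0 → f i = 1) → ∏ i, f i = ∏ i : S, f i := by
    intro f hf
    rw [Finset.prod_coe_sort S f]
    refine (Finset.prod_subset (Finset.subset_univ S) fun i _ hi => hf i ?_).symm
    by_contra h
    exact hi (hS (Finsupp.mem_support_iff.2 h))
  have e1 : ∫ ω, ∏ i, X i ω ^ m i ∂μ = ∏ i : S, ∫ ω, X i ω ^ m i ∂μ := by
    have h := (hind.comp (fun i x => x ^ m i) fun i => by fun_prop).integral_fun_prod_eq_prod_integral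
      fun i => ((hX.measurable i).pow_const (m i)).aestronglyMeasurable
    refine Eq.trans ?_ h
    refine integral_congr_ae (Filter.Eventually.of_forall fun ω => ?_)
    exact hprod (fun i => X i ω ^ m i) fun i hi => by simp [hi]
  have e2 : ∫ x, ∏ i, x i ^ m i ∂gaussianPi σ = ∏ i : S, ∫ x, x ^ m i ∂gaussianReal 0 1 := by
    unfold gaussianPi
    rw [integral_fintype_prod_eq_prod fun i x => x ^ m i]
    exact hprod (fun i => ∫ x, x ^ m i ∂gaussianReal 0 1) fun i hi => by simp [hi]
  rw [e1, e2]
  refine Finset.prod_le_prod (fun i _ => ?_) fun i _ =>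
    integral_sign_pow_le (hX.measurable i) (hX.prob_one i) (hX.prob_neg_one i) _
  rw [integral_sign_pow (hX.measurable i) (hX.prob_one i) (hX.prob_neg_one i)]
  split_ifs <;> simp

theorem aeval_eq_sum_monomials (x : σ → ℝ) (p : MvPolynomial σ ℕ) :
    MvPolynomial.aeval x p = ∑ m ∈ p.support, ((p.coeff m : ℕ) : ℝ) * ∏ i, x i ^ m i := by
  rw [MvPolynomial.aeval_def, MvPolynomial.eval₂_eq']
  simp

theorem integrable_aeval_gaussianPi (p : MvPolynomial σ ℕ) :
    Integrable (fun x : σ → ℝ => MvPolynomial.aeval x p) (gaussianPi σ) := by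
  simp_rw [aeval_eq_sum_monomials]
  exact integrable_finsetSum _ fun m _ => (integrable_monomial_gaussianPi m).const_mul _

theorem IsKWiseIndependentRandomSigns.integrable_aeval
    (hX : IsKWiseIndependentRandomSigns K X μ) (p : MvPolynomial σ ℕ) :
    Integrable (fun ω => MvPolynomial.aeval (fun i => X i ω) p) μ := by
  simp_rw [aeval_eq_sum_monomials]
  exact integrable_finsetSum _ fun m _ => (hX.integrable_monomial m).const_mul _

/-- Polynomials with nonnegative coefficients of low degree have a larger mean at Gaussian
variables than at random signs. -/
theorem IsKWiseIndependentRandomSigns.integral_aeval_le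
    (hX : IsKWiseIndependentRandomSigns K X μ) (hK : K ≤ Fintype.card σ) {p : MvPolynomial σ ℕ}
    (hp : p.totalDegree ≤ K) :
    ∫ ω, MvPolynomial.aeval (fun i => X i ω) p ∂μ ≤
      ∫ x, MvPolynomial.aeval x p ∂gaussianPi σ := by
  simp_rw [aeval_eq_sum_monomials]
  rw [integral_finsetSum _ fun m _ => (hX.integrable_monomial m).const_mul _,
    integral_finsetSum _ fun m _ => (integrable_monomial_gaussianPi m).const_mul _]
  refine Finset.sum_le_sum fun m hm => ?_
  rw [integral_const_mul, integral_const_mul]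
  refine mul_le_mul_of_nonneg_left (hX.integral_monomial_le hK ?_) (Nat.cast_nonneg _)
  refine le_trans ?_ ((MvPolynomial.le_totalDegree hm).trans hp)
  rw [Finset.card_eq_sum_ones]
  exact Finset.sum_le_sum fun i hi => Nat.one_le_iff_ne_zero.2 (Finsupp.mem_support_iff.1 hi)

end signs

/-! ### The trace as a polynomial and as a bound for the norm. -/

section trace

variable {n N : ℕ}

/-- The `n × N` matrix whose entries are the variables of a polynomial ring. -/
noncomputable def genericMatrix (n N : ℕ) :
    Matrix (Fin n) (Fin N) (MvPolynomial (Fin n × Fin N) ℕ) :=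
  Matrix.of fun i j => MvPolynomial.X (i, j)

theorem aeval_trace_genericMatrix (k : ℕ) (x : Fin n × Fin N → ℝ) :
    MvPolynomial.aeval x (trace ((genericMatrix n N * (genericMatrix n N)ᵀ) ^ k)) =
      trace ((ofEntries x * (ofEntries x)ᵀ) ^ k) := by
  let f : MvPolynomial (Fin n × Fin N) ℕ →+* ℝ := (MvPolynomial.aeval x).toRingHom
  change f _ = _
  rw [AddMonoidHom.map_trace f]
  congr 1
  change f.mapMatrix _ = _
  rw [map_pow]
  congr 1
  ext i j
  simp [Matrix.mul_apply, ofEntries, genericMatrix, f]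

theorem totalDegree_genericMatrix_gram_pow_le (k : ℕ) (i j : Fin n) :
    (((genericMatrix n N * (genericMatrix n N)ᵀ) ^ k) i j).totalDegree ≤ 2 * k := by
  induction k generalizing i j with
  | zero => rcases eq_or_ne i j with rfl | hij <;> simp [*]
  | succ k ih =>
    rw [pow_succ, Matrix.mul_apply]
    refine MvPolynomial.totalDegree_finsetSum_le fun l _ => ?_
    refine (MvPolynomial.totalDegree_mul _ _).trans (add_le_add (ih i l) ?_)
    rw [Matrix.mul_apply]
    refine MvPolynomial.totalDegree_finsetSum_le fun l _ => ?_
    refine (MvPolynomial.totalDegree_mul _ _).trans ?_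
    simp [genericMatrix]

theorem totalDegree_trace_genericMatrix_le (n N k : ℕ) :
    (trace ((genericMatrix n N * (genericMatrix n N)ᵀ) ^ k)).totalDegree ≤ 2 * k :=
  MvPolynomial.totalDegree_finsetSum_le fun i _ => totalDegree_genericMatrix_gram_pow_le k i i

-- The left side is the `k`-th power of the largest eigenvalue of `A * Aᵀ`, and the trace is the sum
-- of the `k`-th powers of all of them, which are nonnegative.
open scoped Matrix.Norms.L2Operator in
theorem euclideanOpNorm_pow_le_trace (A : Matrix (Fin n) (Fin N) ℝ) (k : ℕ) (hn : 1 ≤ n) :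
    euclideanOpNorm A ^ (2 * k) ≤ trace ((A * Aᵀ) ^ k) := by
  have hpsd : (A * Aᵀ).PosSemidef := by
    simpa using Matrix.posSemidef_self_mul_conjTranspose A
  have hH := hpsd.isHermitian
  have hnorm : euclideanOpNorm A ^ 2 = ‖A * Aᵀ‖ := by
    have h1 := Matrix.l2_opNorm_conjTranspose_mul_self Aᴴ
    rw [Matrix.l2_opNorm_conjTranspose, conjTranspose_conjTranspose] at h1
    rw [sq, show euclideanOpNorm A = ‖A‖ from rfl]
    simpa using h1.symm
  have hnorm2 : ‖A * Aᵀ‖ = ‖hH.eigenvalues‖ := by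
    conv_lhs => rw [hH.spectral_theorem, Unitary.conjStarAlgAut_apply]
    rw [← Unitary.coe_star, CStarRing.norm_mul_coe_unitary, CStarRing.norm_coe_unitary_mul,
      Matrix.l2_opNorm_diagonal]
    rfl
  have htr : trace ((A * Aᵀ) ^ k) = ∑ i, hH.eigenvalues i ^ k := by
    conv_lhs => rw [hH.spectral_theorem, ← map_pow, Unitary.conjStarAlgAut_apply]
    rw [Matrix.trace_mul_cycle]
    simp [diagonal_pow, trace_diagonal]
  have : Nonempty (Fin n) := ⟨⟨0, hn⟩⟩
  obtain ⟨i, -, hi⟩ := Finset.exists_max_image Finset.univ hH.eigenvalues Finset.univ_nonempty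
  rw [pow_mul, hnorm, hnorm2, htr]
  have h0 := hpsd.eigenvalues_nonneg
  have hle : ‖hH.eigenvalues‖ ≤ hH.eigenvalues i := by
    refine (pi_norm_le_iff_of_nonneg (h0 i)).2 fun j => ?_
    rw [Real.norm_of_nonneg (h0 j)]
    exact hi j (Finset.mem_univ j)
  refine (pow_le_pow_left₀ (norm_nonneg _) hle k).trans ?_
  exact Finset.single_le_sum (f := fun i => hH.eigenvalues i ^ k)
    (fun j _ => pow_nonneg (h0 j) k) (Finset.mem_univ i)

end trace

/-! ### The tail bound. -/

theorem integral_trace_gram_pow_gaussianPi_le {n N k : ℕ} (hn : 1 ≤ n) (hnN : n ≤ N)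
    (hk : (k : ℝ) ≤ 1 / 4 * Real.sqrt N) :
    ∫ x, trace ((ofEntries x * (ofEntries x)ᵀ) ^ k) ∂gaussianPi (Fin n × Fin N) ≤
      2 * n * (Real.sqrt N + Real.sqrt n) ^ (2 * k) := by
  have h0 : ∀ x : Fin n × Fin N → ℝ, 0 ≤ trace ((ofEntries x * (ofEntries x)ᵀ) ^ k) :=
    fun x => (posSemidef_mul_transpose_pow _ k).trace_nonneg
  have hint : Integrable (fun x => trace ((ofEntries x * (ofEntries x)ᵀ) ^ k))
      (gaussianPi (Fin n × Fin N)) := by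
    simp_rw [← aeval_trace_genericMatrix]
    exact integrable_aeval_gaussianPi _
  have h := lintegral_trace_gram_pow_le hn hnN hk
  rw [← ofReal_integral_eq_lintegral_ofReal hint (Filter.Eventually.of_forall h0)] at h
  exact (ENNReal.ofReal_le_ofReal_iff (by positivity)).1 h

/-- Uses `(1 + t / a)⁻¹ = 1 - t / (a + t) ≤ exp (-(t / (a + t)))`. -/
theorem zpow_neg_le_exp {a t : ℝ} (ha : 0 < a) (ht : 0 ≤ t) (k : ℕ) :
    (1 + t / a) ^ (-(2 * (k : ℤ))) ≤ Real.exp (-(2 * (k : ℝ) * t) / (a + t)) := by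
  have h1 : (1 + t / a)⁻¹ = 1 - t / (a + t) := by
    have : a + t ≠ 0 := by positivity
    field_simp
    ring
  have h2 : (1 + t / a)⁻¹ ≤ Real.exp (-(t / (a + t))) := by
    rw [h1]
    linarith [Real.add_one_le_exp (-(t / (a + t)))]
  have e : (1 + t / a) ^ (-(2 * (k : ℤ))) = ((1 + t / a)⁻¹) ^ (2 * k) := by
    rw [_root_.zpow_neg, inv_pow]
    norm_cast
  rw [e]
  refine (pow_le_pow_left₀ (by positivity) h2 _).trans (le_of_eq ?_)
  rw [← Real.exp_nat_mul]
  congr 1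
  push_cast
  ring

theorem lemma2p1 :
    ∃ c₂ : ℝ, 0 < c₂ ∧
      ∀ (Ω : Type*) [MeasurableSpace Ω] (μ : Measure Ω) [IsProbabilityMeasure μ]
        (n N k : ℕ) (V : Ω → Matrix (Fin n) (Fin N) ℝ) (ξ t : ℝ),
        1 ≤ n → n ≤ N → ξ = (n : ℝ) / (N : ℝ) →
        (k : ℝ) ≤ c₂ * Real.sqrt (N : ℝ) →
        IsKWiseIndependentRandomSigns (2 * k)
          (fun (p : Fin n × Fin N) (ω : Ω) => V ω p.1 p.2) μ →
        0 ≤ t →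
        μ.real {ω | 1 + Real.sqrt ξ + t ≤ 1 / Real.sqrt (N : ℝ) * euclideanOpNorm (V ω)}
            ≤ 2 * (n : ℝ) * (1 + t / (1 + Real.sqrt ξ)) ^ (-(2 * (k : ℤ))) ∧
          2 * (n : ℝ) * (1 + t / (1 + Real.sqrt ξ)) ^ (-(2 * (k : ℤ)))
            ≤ 2 * (n : ℝ) * Real.exp (-(2 * (k : ℝ) * t) / (1 + Real.sqrt ξ + t)) := by
  -- This value keeps the exponential tilts in the Gaussian trace bound at most `1/4`, and `2 * k`
  -- at most `N`.
  refine ⟨1 / 4, by norm_num, ?_⟩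
  intro Ω _ μ _ n N k V ξ t hn hnN hξ hk hV ht
  have ha : 0 < 1 + Real.sqrt ξ := by positivity
  refine ⟨?_, mul_le_mul_of_nonneg_left (zpow_neg_le_exp ha ht k) (by positivity)⟩
  have hN1 : (1 : ℝ) ≤ N := by exact_mod_cast hn.trans hnN
  have hsN : 0 < Real.sqrt N := Real.sqrt_pos.2 (by linarith)
  -- With fewer than `2 * k` entries the independence hypothesis would be vacuous.
  have hcard : 2 * k ≤ Fintype.card (Fin n × Fin N) := by
    have h1 : Real.sqrt N ≤ N := by
      rw [Real.sqrt_le_left (by linarith)]; nlinarith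
    have h2 : ((2 * k : ℕ) : ℝ) ≤ (N : ℕ) := by push_cast; linarith
    have h3 : 2 * k ≤ N := by exact_mod_cast h2
    simpa using h3.trans (Nat.le_mul_of_pos_left N hn)
  set T : Ω → ℝ := fun ω => trace ((V ω * (V ω)ᵀ) ^ k) with hT
  have hTeval : ∀ ω, T ω = MvPolynomial.aeval (fun p : Fin n × Fin N => V ω p.1 p.2)
      (trace ((genericMatrix n N * (genericMatrix n N)ᵀ) ^ k)) := fun ω =>
    (aeval_trace_genericMatrix k fun p : Fin n × Fin N => V ω p.1 p.2).symm
  have hTint : Integrable T μ := by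
    rw [show T = _ from funext hTeval]
    exact hV.integrable_aeval _
  have hTle : ∫ ω, T ω ∂μ ≤ 2 * n * (Real.sqrt N + Real.sqrt n) ^ (2 * k) := by
    rw [show T = _ from funext hTeval]
    refine (hV.integral_aeval_le hcard (totalDegree_trace_genericMatrix_le n N k)).trans ?_
    simp_rw [aeval_trace_genericMatrix]
    exact integral_trace_gram_pow_gaussianPi_le hn hnN hk
  have hT0 : ∀ ω, 0 ≤ T ω := fun ω => (posSemidef_mul_transpose_pow (V ω) k).trace_nonneg
  set ε := (Real.sqrt N * (1 + Real.sqrt ξ + t)) ^ (2 * k) with hε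
  have hε0 : 0 < ε := by positivity
  have hsub : {ω | 1 + Real.sqrt ξ + t ≤ 1 / Real.sqrt (N : ℝ) * euclideanOpNorm (V ω)} ⊆
      {ω | ε ≤ T ω} := by
    intro ω hω
    have h1 : Real.sqrt N * (1 + Real.sqrt ξ + t) ≤ euclideanOpNorm (V ω) := by
      have h2 : 1 + Real.sqrt ξ + t ≤ 1 / Real.sqrt (N : ℝ) * euclideanOpNorm (V ω) := hω
      rw [one_div, ← div_eq_inv_mul, le_div_iff₀ hsN] at h2
      linarith
    exact (pow_le_pow_left₀ (by positivity) h1 _).trans (euclideanOpNorm_pow_le_trace (V ω) k hn)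
  have hmarkov := mul_meas_ge_le_integral_of_nonneg (Filter.Eventually.of_forall hT0) hTint ε
  have hA : Real.sqrt N + Real.sqrt n = Real.sqrt N * (1 + Real.sqrt ξ) := by
    rw [hξ, Real.sqrt_div (Nat.cast_nonneg n)]
    field_simp
  have hzpow : (1 + t / (1 + Real.sqrt ξ)) ^ (-(2 * (k : ℤ))) =
      (Real.sqrt N * (1 + Real.sqrt ξ)) ^ (2 * k) / ε := by
    have h1 : (1 + t / (1 + Real.sqrt ξ)) = (Real.sqrt N * (1 + Real.sqrt ξ + t)) /
        (Real.sqrt N * (1 + Real.sqrt ξ)) := by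
      field_simp
    have h2 : (1 + t / (1 + Real.sqrt ξ)) ^ (-(2 * (k : ℤ))) =
        ((1 + t / (1 + Real.sqrt ξ)) ^ (2 * k))⁻¹ := by
      rw [_root_.zpow_neg]
      norm_cast
    rw [h2, h1, div_pow, inv_div]
  rw [hzpow, ← mul_div_assoc, le_div_iff₀ hε0, mul_comm, ← hA]
  refine le_trans ?_ (hmarkov.trans hTle)
  exact mul_le_mul_of_nonneg_left (measureReal_mono hsub) hε0.le
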